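/- **System.** Let $X\subseteq\mathbb R^{n}$ be measurable, let the input set $\mathcal U\subset\mathbb R^{m}$ and the output set $Y$ be finite, let $f(\cdot,u):X\to\mathbb R^{n}$ be Borel measurable for every $u\in\mathcal U$, and let $h:X\to Y$ be measurable. Consider $x_{k+1}=f(x_k,u_k)$, $y_k=h(x_k)$. Its transition system $S_\Sigma$ has state set $\bar X=X\cup\{x_{\rm abs}\}$, all states initial, input set $\mathcal U$, output set $\mathcal Y=Y\cup\{y_{\rm abs}\}$ with $y_{\rm abs}\notin Y$, and exactly one $u$-successor of every state: $f(x,u)$ if $x\in X$ and $f(x,u)\in X$, and $x_{\rm abs}$ otherwise. The output of $x\in X$ is $h(x)$, that of $x_{\rm abs}$ is $y_{\rm abs}$. **Behaviors.** An $H$-long internal behavior of a transition system is a sequence $x_0u_0x_1\dots u_{H-1}x_H$ of states and inputs that starts in an initial state and follows the transitions; the sequence $y_0u_0y_1\dots u_{H-1}y_H$ of the outputs $y_i$ of the $x_i$ together with the inputs is the corresponding external behavior. $\mathcal B_H(S)$ is the set of all $H$-long external behaviors of $S$, and $\mathcal B_H(S_\Sigma,x,\mathbf u_H)$ is the unique one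 of $S_\Sigma$ from $x\in\bar X$ under $\mathbf u_H\in\mathcal U^H$. External behaviors are extended by the symbol $\diamond$ to outputs and inputs with negative index, and $\gamma[i,j]$ is the part of $\gamma$ from $y_i$ to $y_j$. **Data-driven SA$\ell$CA.** Let $0\le\ell<H$, let $\mu_x$ and $\mu_{\mathbf u_H}$ be probability measures on $\bar X$ and $\mathcal U^H$, $\mu_p=\mu_x\times\mu_{\mathbf u_H}$, and draw $N$ i.i.d. pairs $(x^i,\mathbf u_H^i)\sim\mu_p$. Let $D=\{\mathcal B_H(S_\Sigma,x^i,\mathbf u^i_H): i=1,\dots,N\}$ and $\hat\Pi_{j}=\{\gamma[k-j,k]:\gamma\in D,\ 0\le k\le H\}$. The data-driven SA$\ell$CA $\hat S_\ell$ is the transition system with state set $\hat\Pi_\ell$, input set $\mathcal U$ and output set $\mathcal Y$, in which - $\zeta\in\hat\Pi_\ell$ is initial iff $\zeta=\gamma[-\ell,0]$ for some $\gamma\in\mathcal B_H(S_\Sigma)$; - the output of $\zeta$ is its last output; - $(\zeta,u,\zeta')$ is a transition iff $\zeta$ without its first output and first input equals $\zeta'$ without its last input and last output, the last input of $\zeta'$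 is $u$, and the concatenation of $\zeta$ with $u$ and the last output of $\zeta'$ is in $\hat\Pi_{\ell+1}$ (for $\ell=0$ only the last of these three conditions is imposed). Let $s^*_{N,\ell}$ be the cardinality of a smallest subset of $D$ that has the same set $\hat\Pi_{\ell+1}$ of $(\ell+1)$-sequences as $D$. **Scenario bound.** For $\beta\in(0,1)$ let $\epsilon(k,\beta,N)=1$ for $k\ge N$, and for $0\le k<N$ let $\epsilon(k,\beta,N)=1-t$, where $t$ is the unique solution in $(0,1)$ of $$\binom Nk t^{N-k}-\frac{\beta}{N}\sum_{i=k}^{N-1}\binom ik t^{i-k}=0 .$$ **Claim.** Let $\mathcal T(\hat S_\ell,H)=\{(x,\mathbf u_H):\mathcal B_H(S_\Sigma,x,\mathbf u_H)\notin\mathcal B_H(\hat S_\ell)\}$. For every $\beta\in(0,1)$ the events below are measurable, and $$\mu_p^N\Big(\mu_p\big((x,\mathbf u_H)\in\mathcal T(\hat S_\ell,H)\big)\le\epsilon(s^*_{N,\ell},\beta,N)\Big)\ \ge\ 1-\beta .$$ -/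

import Mathlib

open MeasureTheory

namespace SALCA

/-- A finite alternating sequence `m₀ a₀ m₁ a₁ … a_{n-1} m_n`. -/
@[ext]
structure AltSeq (M A : Type*) (n : ℕ) where
  m : Fin (n + 1) → M
  a : Fin n → A

namespace AltSeq

variable {M A : Type*} {n : ℕ}

/-- The `ℓ`-long window `s[k-ℓ,k]`, for `k ∈ [0,n]`.  The sequence `s` is extended to negative
indices by the symbol `⋄`, which is `none`. -/
def window (s : AltSeq M A n) (ℓ : ℕ) (k : Fin (n + 1)) :
    AltSeq (Option M) (Option A) ℓ where
  m i := if ℓ ≤ (k : ℕ) + i then some (s.m ⟨(k : ℕ) + i - ℓ, by omega⟩) else none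
  a i := if _ : ℓ ≤ (k : ℕ) + i then some (s.a ⟨(k : ℕ) + i - ℓ, by omega⟩) else none

/-- The sequence `m₀ a₀ … m_n a m`. -/
def append (s : AltSeq M A n) (a : A) (m : M) : AltSeq M A (n + 1) where
  m := Fin.snoc s.m m
  a := Fin.snoc s.a a

theorem window_last_isSome (s : AltSeq M A n) (ℓ : ℕ) (k : Fin (n + 1)) :
    ((s.window ℓ k).m (Fin.last ℓ)).isSome = true := by
  simp [window]

end AltSeq

/-- A transition system with states `X`, inputs `U` and outputs `Y`. -/
structure TransitionSystem (X U Y : Type*) where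
  init : Set X
  δ : X → U → X → Prop
  out : X → Y

namespace TransitionSystem

variable {X U Y : Type*} (S : TransitionSystem X U Y) (H : ℕ)

/-- The `H`-long internal behaviors. -/
def intBeh : Set (AltSeq X U H) :=
  {ξ | ξ.m 0 ∈ S.init ∧ ∀ i : Fin H, S.δ (ξ.m i.castSucc) (ξ.a i) (ξ.m i.succ)}

/-- The external sequence of a sequence of states and inputs. -/
def outSeq {H : ℕ} (ξ : AltSeq X U H) : AltSeq Y U H where
  m i := S.out (ξ.m i)
  a := ξ.a

/-- The `H`-long external behaviors. -/
def extBeh : Set (AltSeq Y U H) :=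
  {γ | ∃ ξ ∈ S.intBeh H, γ = S.outSeq ξ}

/-- The internal behaviors that start in `x` under the input sequence `u`. -/
def intBehFrom (x : X) (u : Fin H → U) : Set (AltSeq X U H) :=
  {ξ ∈ S.intBeh H | ξ.m 0 = x ∧ ξ.a = u}

/-- The external behaviors that start in `x` under the input sequence `u`. -/
def extBehFrom (x : X) (u : Fin H → U) : Set (AltSeq Y U H) :=
  {γ ∈ S.extBeh H | ∃ ξ ∈ S.intBehFrom H x u, γ = S.outSeq ξ}

/-- The external behaviors collected from the samples `(xⁱ, uⁱ)`. -/
def sampledBeh {N : ℕ} (ω : Fin N → X × (Fin H → U)) : Set (AltSeq Y U H) :=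
  {γ | ∃ i, γ ∈ S.extBehFrom H (ω i).1 (ω i).2}

end TransitionSystem

/-- All `ℓ`-sequences of the sequences in `D`. -/
def lSeqs {Y U : Type*} {H : ℕ} (ℓ : ℕ) (D : Set (AltSeq Y U H)) :
    Set (AltSeq (Option Y) (Option U) ℓ) :=
  {ζ | ∃ γ ∈ D, ∃ k : Fin (H + 1), ζ = γ.window ℓ k}

theorem lSeqs_last_isSome {Y U : Type*} {H ℓ : ℕ} {D : Set (AltSeq Y U H)}
    {ζ : AltSeq (Option Y) (Option U) ℓ} (hζ : ζ ∈ lSeqs ℓ D) :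
    (ζ.m (Fin.last ℓ)).isSome = true := by
  obtain ⟨γ, -, k, rfl⟩ := hζ
  exact γ.window_last_isSome ℓ k

/-- The data-driven (strongest asynchronous) `ℓ`-complete abstraction of `S` built from a set `D`
of external behaviors.  In the transition relation, the first two conditions say
`ζ[1,ℓ] = ζ'[0,ℓ-1]`, the third says that the last input of `ζ'` is `u`, and the fourth says that
the concatenation `ζ · ζ'[ℓ-1,ℓ]` is an `(ℓ+1)`-sequence of `D`. -/
def dataDrivenSALCA {X U Y : Type*} (S : TransitionSystem X U Y) {H : ℕ} (ℓ : ℕ)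
    (D : Set (AltSeq Y U H)) : TransitionSystem (lSeqs ℓ D) U Y where
  init := {ζ | ∃ ξ ∈ S.intBeh H, (S.outSeq ξ).window ℓ 0 = ζ.1}
  δ ζ u ζ' :=
    (∀ i : Fin ℓ, ζ.1.m i.succ = ζ'.1.m i.castSucc) ∧
    (∀ i j : Fin ℓ, (i : ℕ) = j + 1 → ζ.1.a i = ζ'.1.a j) ∧
    (∀ i : Fin ℓ, (i : ℕ) + 1 = ℓ → ζ'.1.a i = some u) ∧
    ζ.1.append (some u) (ζ'.1.m (Fin.last ℓ)) ∈ lSeqs (ℓ + 1) D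
  out ζ := (ζ.1.m (Fin.last ℓ)).get (lSeqs_last_isSome ζ.2)

/-- The complexity: the cardinality of a smallest subset of `D` that yields the same set of
`(ℓ+1)`-sequences as `D`. -/
noncomputable def complexity {Y U : Type*} {H : ℕ} (ℓ : ℕ) (D : Set (AltSeq Y U H)) : ℕ :=
  sInf {n : ℕ | ∃ D' ⊆ D, lSeqs (ℓ + 1) D' = lSeqs (ℓ + 1) D ∧ D'.encard = n}

/-- The violation set: the pairs `(x, u)` whose external behavior in `S` is not an external
behavior of `S'`.  (For a deterministic `S` with free input and all states initial, the set
`S.extBehFrom H x u` has exactly one element.) -/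
def violationSet {X X' U Y : Type*} (S : TransitionSystem X U Y) (S' : TransitionSystem X' U Y)
    (H : ℕ) : Set (X × (Fin H → U)) :=
  {p | ∃ γ ∈ S.extBehFrom H p.1 p.2, γ ∉ S'.extBeh H}

section Concrete

variable {n m : ℕ} {X : Set (EuclideanSpace ℝ (Fin n))} {U : Set (EuclideanSpace ℝ (Fin m))}
  {Y : Type*}

open Classical in
/-- One step of the dynamics on the states `X` together with the absorbing state `Sum.inr ()`,
which is entered when `f` leaves `X`. -/
noncomputable def step (f : X → U → EuclideanSpace ℝ (Fin n)) : X ⊕ Unit → U → X ⊕ Unit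
  | Sum.inl x, u => if hx : f x u ∈ X then Sum.inl ⟨f x u, hx⟩ else Sum.inr ()
  | Sum.inr _, _ => Sum.inr ()

/-- The transition system of `x_{k+1} = f(x_k, u_k)`, `y_k = h(x_k)`, with all states initial.
The absorbing state has its own output label `Sum.inr ()`. -/
def concreteTS (f : X → U → EuclideanSpace ℝ (Fin n)) (h : X → Y) :
    TransitionSystem (X ⊕ Unit) U (Y ⊕ Unit) where
  init := Set.univ
  δ x u x' := x' = step f x u
  out := Sum.map h id

end Concrete

/-- The polynomial `C(N,k) t^(N-k) - (β/N) ∑_{i=k}^{N-1} C(i,k) t^(i-k)`. -/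
noncomputable def scenarioPoly (k : ℕ) (β : ℝ) (N : ℕ) (t : ℝ) : ℝ :=
  (N.choose k : ℝ) * t ^ (N - k)
    - β / N * ∑ i ∈ Finset.Ico k N, (i.choose k : ℝ) * t ^ (i - k)

/-- The scenario bound `ε(k, β, N)`: for `k < N` it is `1 - t` with `t` the unique zero of the
polynomial in `(0,1)`, and otherwise it is `1`. -/
noncomputable def scenarioEps (k : ℕ) (β : ℝ) (N : ℕ) : ℝ :=
  if k < N then 1 - sSup {t : ℝ | t ∈ Set.Ioo 0 1 ∧ scenarioPoly k β N t = 0} else 1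

theorem existsUnique_scenarioPoly_eq_zero {k N : ℕ} {β : ℝ} (hk : k < N) (hβ : 0 < β)
    (hβ1 : β < 1) : ∃! t : ℝ, t ∈ Set.Ioo 0 1 ∧ scenarioPoly k β N t = 0 := by
  have hN : (0 : ℝ) < N := by exact_mod_cast (by omega : 0 < N)
  have hC : (0 : ℝ) < N.choose k := by exact_mod_cast Nat.choose_pos hk.le
  have hc : 0 < β / N := by positivity
  have key : ∀ s t : ℝ, 0 < s → s < t → scenarioPoly k β N s = 0 →
      scenarioPoly k β N t = 0 → False := by
    intro s t hs hst h1 h2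
    simp only [scenarioPoly, sub_eq_zero] at h1 h2
    have hr : 1 < t / s := (one_lt_div hs).2 hst
    have hlt : ∑ i ∈ Finset.Ico k N, (i.choose k : ℝ) * t ^ (i - k)
        < (t / s) ^ (N - k) * ∑ i ∈ Finset.Ico k N, (i.choose k : ℝ) * s ^ (i - k) := by
      rw [Finset.mul_sum]
      refine Finset.sum_lt_sum_of_nonempty ⟨k, by simp [hk]⟩ fun i hi => ?_
      rw [Finset.mem_Ico] at hi
      have hci : (0 : ℝ) < i.choose k := by exact_mod_cast Nat.choose_pos hi.1
      have hp : (t / s) ^ (i - k) < (t / s) ^ (N - k) :=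
        pow_lt_pow_right₀ hr (by omega)
      have ht : t ^ (i - k) = (t / s) ^ (i - k) * s ^ (i - k) := by
        rw [← mul_pow, div_mul_cancel₀ _ hs.ne']
      rw [ht]
      have hsp : 0 < s ^ (i - k) := pow_pos hs _
      calc (i.choose k : ℝ) * ((t / s) ^ (i - k) * s ^ (i - k))
          = (t / s) ^ (i - k) * ((i.choose k : ℝ) * s ^ (i - k)) := by ring
        _ < (t / s) ^ (N - k) * ((i.choose k : ℝ) * s ^ (i - k)) :=
            mul_lt_mul_of_pos_right hp (mul_pos hci hsp)
    have h3 := mul_lt_mul_of_pos_left hlt hc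
    rw [← h2] at h3
    have h4 : β / N * ((t / s) ^ (N - k) *
        ∑ i ∈ Finset.Ico k N, (i.choose k : ℝ) * s ^ (i - k))
        = (N.choose k : ℝ) * t ^ (N - k) := by
      rw [mul_left_comm, ← h1, mul_left_comm, ← mul_pow, div_mul_cancel₀ _ hs.ne']
    exact absurd h3 (by rw [h4]; exact lt_irrefl _)
  have h0 : scenarioPoly k β N 0 < 0 := by
    have hsum : ∑ i ∈ Finset.Ico k N, (i.choose k : ℝ) * (0 : ℝ) ^ (i - k) = 1 := by
      rw [Finset.sum_eq_single k]
      · simp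
      · intro i hi hik
        rw [Finset.mem_Ico] at hi
        rw [zero_pow (by omega), mul_zero]
      · intro h
        exact absurd (Finset.mem_Ico.2 ⟨le_rfl, hk⟩) h
    rw [scenarioPoly, hsum, zero_pow (by omega)]
    linarith
  have h1 : 0 < scenarioPoly k β N 1 := by
    have hsum : ∑ i ∈ Finset.Ico k N, (i.choose k : ℝ) * (1 : ℝ) ^ (i - k)
        = N.choose (k + 1) := by
      have := Nat.sum_Icc_choose (N - 1) k
      have hI : Finset.Icc k (N - 1) = Finset.Ico k N := by
        ext i
        simp only [Finset.mem_Icc, Finset.mem_Ico]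
        omega
      rw [hI, Nat.sub_add_cancel (by omega)] at this
      rw [← this]
      simp
    rw [scenarioPoly, hsum, one_pow, mul_one]
    have hle : (N.choose (k + 1) : ℝ) ≤ N.choose k * N := by
      have h := Nat.choose_succ_right_eq N k
      have : N.choose (k + 1) ≤ N.choose k * N :=
        calc N.choose (k + 1) ≤ N.choose (k + 1) * (k + 1) := Nat.le_mul_of_pos_right _ (by omega)
          _ = N.choose k * (N - k) := h
          _ ≤ N.choose k * N := Nat.mul_le_mul_left _ (by omega)
      exact_mod_cast this
    have : β / N * N.choose (k + 1) ≤ β * N.choose k := by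
      calc β / N * N.choose (k + 1) ≤ β / N * (N.choose k * N) :=
            mul_le_mul_of_nonneg_left hle hc.le
        _ = β * N.choose k := by field_simp
    nlinarith
  have hcont : Continuous (scenarioPoly k β N) := by
    unfold scenarioPoly
    fun_prop
  obtain ⟨t, ht, hzero⟩ :=
    intermediate_value_Ioo (zero_le_one (α := ℝ)) hcont.continuousOn ⟨h0, h1⟩
  refine ⟨t, ⟨ht, hzero⟩, ?_⟩
  rintro s ⟨hs, hs0⟩
  rcases lt_trichotomy s t with h | h | h
  · exact (key s t hs.1 h hs0 hzero).elim
  · exact h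
  · exact (key t s ht.1 h hzero hs0).elim

theorem scenarioEps_eq {k N : ℕ} {β t : ℝ} (hk : k < N) (hβ : 0 < β) (hβ1 : β < 1)
    (ht : t ∈ Set.Ioo 0 1) (h0 : scenarioPoly k β N t = 0) : scenarioEps k β N = 1 - t := by
  have hs : {t : ℝ | t ∈ Set.Ioo 0 1 ∧ scenarioPoly k β N t = 0} = {t} := by
    ext s
    constructor
    · intro hs
      exact (existsUnique_scenarioPoly_eq_zero hk hβ hβ1).unique hs ⟨ht, h0⟩
    · rintro rfl
      exact ⟨ht, h0⟩
  rw [scenarioEps, if_pos hk, hs, csSup_singleton]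

end SALCA

/-! There are only finitely many external behaviors, so the samples act as `N` independent draws
from weights `q` on a finite set. A behavior whose `(ℓ+1)`-windows all occur in the data is
reproduced by the abstraction (`mem_extBeh_dataDrivenSALCA`). Let `K` be a smallest subset of the
data with the same windows, `k = #K`, and `t` the weight of the set `A K` of behaviors without
windows outside those of `K`. The violation probability is then at most `1 - t`. Ties in the choice
of `K` are broken consistently (`exists_minimal_compression`), so discarding unchosen data leaves
`K` unchanged.

Let `p m K` be the probability that `m` draws are compressed to `K`. Of `m + 1` draws compressed to
`K`, at least `m + 1 - k` can be discarded singly with `K` unchanged, and each discarded point lies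
in `A K`. By independence `(m + 1 - k) p (m+1) K ≤ (m + 1) t p m K`, which is iterated. If `1 - t`
exceeds the scenario bound, then `t` lies below the zero of `scenarioPoly`, and nonpositivity there
turns the iterated inequalities into `p N K ≤ (β/N) ∑_{m<N} p m K`. Since `∑_K p m K = 1` for every
`m`, summing over the bad `K` gives at most `β` (`sum_prod_violation_le`). -/

namespace SALCA

/-! ### Sign of the scenario polynomial below its zero. -/

section ScenarioBound

theorem continuous_scenarioPoly (k : ℕ) (β : ℝ) (N : ℕ) : Continuous (scenarioPoly k β N) := by
  unfold scenarioPoly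
  fun_prop

theorem scenarioPoly_zero_neg {k N : ℕ} {β : ℝ} (hk : k < N) (hβ : 0 < β) :
    scenarioPoly k β N 0 < 0 := by
  have hN : (0 : ℝ) < N := by exact_mod_cast (by omega : 0 < N)
  have hsum : ∑ i ∈ Finset.Ico k N, (i.choose k : ℝ) * (0 : ℝ) ^ (i - k) = 1 := by
    rw [Finset.sum_eq_single k]
    · simp
    · intro i hi hik
      rw [Finset.mem_Ico] at hi
      rw [zero_pow (by omega), mul_zero]
    · intro h
      exact absurd (Finset.mem_Ico.2 ⟨le_rfl, hk⟩) h
  rw [scenarioPoly, hsum, zero_pow (by omega)]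
  have : 0 < β / N := by positivity
  linarith

/-- Below its unique zero in `(0,1)` the polynomial is nonpositive. -/
theorem scenarioPoly_nonpos_of_lt {k N : ℕ} {β t : ℝ} (hk : k < N) (hβ : 0 < β) (hβ1 : β < 1)
    (ht : 0 ≤ t) (hlt : scenarioEps k β N < 1 - t) : scenarioPoly k β N t ≤ 0 := by
  obtain ⟨r, ⟨hr, hr0⟩, huniq⟩ := existsUnique_scenarioPoly_eq_zero hk hβ hβ1
  rw [scenarioEps_eq hk hβ hβ1 hr hr0] at hlt
  -- A positive value at `t` would force a zero in `(0, t)`, but the unique zero `r` satisfies `t <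
  -- r`.
  by_contra! hpos
  obtain ⟨s, hs, hs0⟩ := intermediate_value_Ioo ht (continuous_scenarioPoly k β N).continuousOn
    ⟨scenarioPoly_zero_neg hk hβ, hpos⟩
  have := huniq s ⟨⟨hs.1, by linarith [hs.2, hr.2]⟩, hs0⟩
  linarith [hs.2]

end ScenarioBound

/-! ### Scenario bound for compression maps on a finite sample space. -/

section Compression

/-- All but at most `#K` of the points of a finite family can be removed singly without losing
an element of `K`. -/
theorem card_le_card_removable {Z : Type*} [DecidableEq Z] {m : ℕ} {K : Finset Z} {ω : Fin (m + 1) → Z}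
    (hK : K ⊆ Finset.univ.image ω) :
    m + 1 ≤ (Finset.univ.filter fun i : Fin (m + 1) =>
      K ⊆ Finset.univ.image fun j => ω (i.succAbove j)).card + K.card := by
  have hsplit := Finset.card_filter_add_card_filter_not (s := (Finset.univ : Finset (Fin (m + 1))))
    (fun i => K ⊆ Finset.univ.image fun j => ω (i.succAbove j))
  rw [Finset.card_univ, Fintype.card_fin] at hsplit
  -- If removing `i` loses an element of `K`, that element is `ω i` and is drawn at no other index.
  -- Hence `ω` injects the non-removable indices into `K`.
  have hex : ∀ i : Fin (m + 1), (¬ K ⊆ Finset.univ.image fun j => ω (i.succAbove j)) →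
      ω i ∈ K ∧ ∀ j, ω j = ω i → j = i := by
    intro i hi
    obtain ⟨z, hz, hzn⟩ := Finset.not_subset.1 hi
    have hne : ∀ j, ω j = z → j = i := by
      intro j hj
      by_contra hji
      obtain ⟨j', rfl⟩ := Fin.exists_succAbove_eq hji
      exact hzn (Finset.mem_image.2 ⟨j', Finset.mem_univ _, hj⟩)
    obtain ⟨j, -, hj⟩ := Finset.mem_image.1 (hK hz)
    obtain rfl := hne j hj
    subst hj
    exact ⟨hz, hne⟩
  have hle : (Finset.univ.filter fun i : Fin (m + 1) =>
      ¬ K ⊆ Finset.univ.image fun j => ω (i.succAbove j)).card ≤ K.card := by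
    refine Finset.card_le_card_of_injOn ω (fun i hi => (hex i (by simpa using hi)).1) ?_
    intro i _ j hj hij
    exact (hex j (by simpa using hj)).2 i hij
  omega

/-- For a monotone set function `F`, smallest generating subsets can be chosen consistently: the
choice does not change when points that have not been chosen are removed. -/
theorem exists_minimal_compression {Z W : Type*} [Fintype Z] (F : Finset Z → Set W) (hF : Monotone F) :
    ∃ c : Finset Z → Finset Z, (∀ D, c D ⊆ D) ∧ (∀ D, F (c D) = F D) ∧
      (∀ D B, B ⊆ D → F B = F D → (c D).card ≤ B.card) ∧
      ∀ D D', c D ⊆ D' → D' ⊆ D → c D' = c D := by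
  classical
  let e := Fintype.equivFin (Finset Z)
  -- Rank by cardinality first, then by an arbitrary enumeration: injectivity makes the minimizer
  -- unique, which the consistency of the choice requires.
  let r : Finset Z → ℕ ×ₗ Fin (Fintype.card (Finset Z)) := fun B => toLex (B.card, e B)
  have hr : Function.Injective r := by
    intro B B' h
    have := congrArg (fun p => (ofLex p).2) h
    exact e.injective this
  have hex : ∀ D : Finset Z, ∃ B ∈ D.powerset.filter (fun B => F B = F D),
      ∀ B' ∈ D.powerset.filter (fun B => F B = F D), r B ≤ r B' := fun D =>
    Finset.exists_min_image _ r ⟨D, by simp⟩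
  choose c hc hmin using hex
  simp only [Finset.mem_filter, Finset.mem_powerset] at hc hmin
  refine ⟨c, fun D => (hc D).1, fun D => (hc D).2, fun D B hB hFB => ?_, fun D D' h1 h2 => ?_⟩
  · have := hmin D B ⟨hB, hFB⟩
    rcases Prod.Lex.toLex_le_toLex.1 this with h | h
    · exact h.le
    · exact h.1.le
  · have hFD : F D' = F D := (hF h2).antisymm ((hc D).2 ▸ hF h1)
    refine hr (le_antisymm ?_ ?_)
    · exact hmin D' _ ⟨h1, (hc D).2.trans hFD.symm⟩
    · exact hmin D _ ⟨(hc D').1.trans h2, (hc D').2.trans hFD⟩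

variable {Z : Type*} [Fintype Z] [DecidableEq Z]

/-- The probability, under `m` independent draws from the weights `q`, that the set of the drawn
points is compressed to `K`. -/
noncomputable def compressionProb (q : Z → ℝ) (c : Finset Z → Finset Z) (m : ℕ)
    (K : Finset Z) : ℝ :=
  ∑ ω : Fin m → Z, if c (Finset.univ.image ω) = K then ∏ i, q (ω i) else 0

variable {q : Z → ℝ} {c : Finset Z → Finset Z}

theorem compressionProb_nonneg (hq : ∀ z, 0 ≤ q z) (m : ℕ) (K : Finset Z) :
    0 ≤ compressionProb q c m K := by
  refine Finset.sum_nonneg fun ω _ => ?_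
  split_ifs
  · exact Finset.prod_nonneg fun i _ => hq _
  · exact le_rfl

theorem sum_compressionProb (hq1 : ∑ z, q z = 1) (m : ℕ) :
    ∑ K, compressionProb q c m K = 1 := by
  unfold compressionProb
  rw [Finset.sum_comm]
  simp only [Finset.sum_ite_eq, Finset.mem_univ, if_true]
  rw [← Fintype.prod_sum (fun (_ : Fin m) z => q z)]
  simp [hq1]

/-- Removing one of `m + 1` sampled points: the basic inequality between the compression
probabilities for `m + 1` and for `m` points. -/
theorem compressionProb_succ_le (hq : ∀ z, 0 ≤ q z)
    (hsub : ∀ D, c D ⊆ D) (hpref : ∀ D D', c D ⊆ D' → D' ⊆ D → c D' = c D)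
    (A : Finset Z → Finset Z) (hA : ∀ D, D ⊆ A (c D)) (m : ℕ) (K : Finset Z) :
    ((m : ℝ) + 1 - K.card) * compressionProb q c (m + 1) K
      ≤ (m + 1) * ((∑ z ∈ A K, q z) * compressionProb q c m K) := by
  -- By independence, each `i` contributes the probability that the `i`-th draw lies in `A K` and
  -- the other `m` draws are compressed to `K`.
  have hrhs : ((m : ℝ) + 1) * ((∑ z ∈ A K, q z) * compressionProb q c m K)
      = ∑ i : Fin (m + 1), ∑ ω : Fin (m + 1) → Z,
        if ω i ∈ A K ∧ c (Finset.univ.image fun j => ω (i.succAbove j)) = K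
          then ∏ j, q (ω j) else 0 := by
    have hi : ∀ i : Fin (m + 1), (∑ ω : Fin (m + 1) → Z,
        if ω i ∈ A K ∧ c (Finset.univ.image fun j => ω (i.succAbove j)) = K
          then ∏ j, q (ω j) else 0) = (∑ z ∈ A K, q z) * compressionProb q c m K := by
      intro i
      rw [← (Fin.insertNthEquiv (fun _ => Z) i).sum_comp, Fintype.sum_prod_type,
        ← Finset.sum_filter_add_sum_filter_not Finset.univ (fun z => z ∈ A K),
        Finset.filter_mem_eq_inter, Finset.univ_inter, Finset.sum_mul]
      rw [Finset.sum_eq_zero (s := Finset.univ.filter fun z => ¬ z ∈ A K), add_zero]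
      · refine Finset.sum_congr rfl fun z hz => ?_
        rw [compressionProb, Finset.mul_sum]
        refine Finset.sum_congr rfl fun ω _ => ?_
        simp [hz, Fin.prod_univ_succAbove _ i]
      · intro z hz
        rw [Finset.mem_filter] at hz
        refine Finset.sum_eq_zero fun ω _ => ?_
        simp [hz.2]
    simp only [hi, Finset.sum_const, Finset.card_univ, Fintype.card_fin, nsmul_eq_mul]
    push_cast
    ring
  rw [hrhs, Finset.sum_comm, compressionProb, Finset.mul_sum]
  refine Finset.sum_le_sum fun ω _ => ?_
  have hprod : 0 ≤ ∏ j, q (ω j) := Finset.prod_nonneg fun i _ => hq _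
  split_ifs with hc
  · rw [← Finset.sum_filter, Finset.sum_const, nsmul_eq_mul]
    refine mul_le_mul_of_nonneg_right ?_ hprod
    have h1 := card_le_card_removable (hc ▸ hsub (Finset.univ.image ω))
    -- After a removable index is dropped, the remaining data lie between `K` and the full data, so
    -- `hpref` keeps the compression equal to `K`.
    have h2 : (Finset.univ.filter fun i : Fin (m + 1) =>
        K ⊆ Finset.univ.image fun j => ω (i.succAbove j)).card
        ≤ (Finset.univ.filter fun i : Fin (m + 1) => ω i ∈ A K ∧
          c (Finset.univ.image fun j => ω (i.succAbove j)) = K).card := by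
      refine Finset.card_le_card fun i hi => ?_
      rw [Finset.mem_filter] at hi ⊢
      refine ⟨hi.1, ?_, ?_⟩
      · rw [← hc]
        exact hA _ (Finset.mem_image_of_mem _ (Finset.mem_univ i))
      · rw [← hc]
        refine hpref _ _ (hc ▸ hi.2) ?_
        intro z hz
        obtain ⟨j, -, rfl⟩ := Finset.mem_image.1 hz
        exact Finset.mem_image_of_mem _ (Finset.mem_univ _)
    have h3 : ((m + 1 : ℕ) : ℝ) ≤ ((Finset.univ.filter fun i : Fin (m + 1) => ω i ∈ A K ∧
          c (Finset.univ.image fun j => ω (i.succAbove j)) = K).card + K.card : ℕ) := by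
      exact_mod_cast h1.trans (by omega)
    push_cast at h3
    linarith
  · rw [mul_zero]
    refine Finset.sum_nonneg fun i _ => ?_
    split_ifs
    · exact hprod
    · exact le_rfl

/-- Iterates the one-point removal: the factors `(i + 1) / (i + 1 - #K)` for `m ≤ i < N` telescope
to the quotient of the two binomial coefficients. -/
theorem choose_mul_compressionProb_le (hq : ∀ z, 0 ≤ q z)
    (hsub : ∀ D, c D ⊆ D) (hpref : ∀ D D', c D ⊆ D' → D' ⊆ D → c D' = c D)
    (A : Finset Z → Finset Z) (hA : ∀ D, D ⊆ A (c D)) (K : Finset Z) {m N : ℕ}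
    (hKm : K.card ≤ m) (hmN : m ≤ N) :
    (m.choose K.card : ℝ) * compressionProb q c N K
      ≤ N.choose K.card * (∑ z ∈ A K, q z) ^ (N - m) * compressionProb q c m K := by
  induction N, hmN using Nat.le_induction with
  | base => simp
  | succ N hmN ih =>
    have ht : 0 ≤ ∑ z ∈ A K, q z := Finset.sum_nonneg fun z _ => hq z
    have hstep := compressionProb_succ_le hq hsub hpref A hA N K
    have hpos : (0 : ℝ) < (N : ℝ) + 1 - K.card := by
      have : (K.card : ℝ) ≤ N := by exact_mod_cast hKm.trans hmN
      linarith
    have hchoose : (N.choose K.card : ℝ) * (N + 1)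
        = (N + 1).choose K.card * ((N : ℝ) + 1 - K.card) := by
      have h := Nat.choose_mul_succ_eq N K.card
      have hle : K.card ≤ N + 1 := by omega
      rw [← Nat.cast_add_one, ← Nat.cast_sub hle]
      exact_mod_cast h
    refine le_of_mul_le_mul_left ?_ hpos
    set t := ∑ z ∈ A K, q z
    calc ((N : ℝ) + 1 - K.card) * (m.choose K.card * compressionProb q c (N + 1) K)
        = m.choose K.card * (((N : ℝ) + 1 - K.card) * compressionProb q c (N + 1) K) := by ring
      _ ≤ m.choose K.card * ((N + 1) * (t * compressionProb q c N K)) := by gcongr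
      _ = (N + 1) * t * (m.choose K.card * compressionProb q c N K) := by ring
      _ ≤ (N + 1) * t * (N.choose K.card * t ^ (N - m) * compressionProb q c m K) := by gcongr
      _ = (N.choose K.card * (N + 1)) * (t ^ (N - m) * t) * compressionProb q c m K := by ring
      _ = _ := by
        rw [hchoose, ← pow_succ, show N - m + 1 = N + 1 - m by omega]
        ring

/-- A set whose violation probability exceeds the scenario bound is rarely the compression of
`N` points. -/
theorem compressionProb_le_of_lt (hq : ∀ z, 0 ≤ q z)
    (hsub : ∀ D, c D ⊆ D) (hpref : ∀ D D', c D ⊆ D' → D' ⊆ D → c D' = c D)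
    (A : Finset Z → Finset Z) (hA : ∀ D, D ⊆ A (c D)) (K : Finset Z) {N : ℕ} {β : ℝ}
    (hβ : 0 < β) (hβ1 : β < 1) (hbad : scenarioEps K.card β N < 1 - ∑ z ∈ A K, q z) :
    compressionProb q c N K ≤ β / N * ∑ m ∈ Finset.range N, compressionProb q c m K := by
  have ht : 0 ≤ ∑ z ∈ A K, q z := Finset.sum_nonneg fun z _ => hq z
  have hp : ∀ m, 0 ≤ compressionProb q c m K := fun m => compressionProb_nonneg hq m K
  have hk : K.card < N := by
    by_contra hk
    rw [scenarioEps, if_neg hk] at hbad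
    linarith
  have hpoly := scenarioPoly_nonpos_of_lt hk hβ hβ1 ht hbad
  have hle := fun {m : ℕ} (h1 : K.card ≤ m) (h2 : m ≤ N) =>
    choose_mul_compressionProb_le hq hsub hpref A hA K h1 h2
  set t := ∑ z ∈ A K, q z
  set k := K.card
  have hC : (0 : ℝ) < N.choose k := by exact_mod_cast Nat.choose_pos hk.le
  have hsum : ∑ m ∈ Finset.Ico k N, compressionProb q c m K
      ≤ ∑ m ∈ Finset.range N, compressionProb q c m K := by
    refine Finset.sum_le_sum_of_subset_of_nonneg ?_ fun m _ _ => hp m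
    intro m hm
    rw [Finset.mem_Ico] at hm
    exact Finset.mem_range.2 hm.2
  refine le_trans ?_ (mul_le_mul_of_nonneg_left hsum (by positivity))
  -- For `t = 0` one cannot cancel `t ^ (N - k)`, but the case `m = k` of `hle` then already makes
  -- the left side vanish.
  rcases ht.eq_or_lt with h0 | h0
  · have h := hle le_rfl hk.le
    rw [← h0, zero_pow (by omega), Nat.choose_self] at h
    have h' : compressionProb q c N K ≤ 0 := by simpa using h
    exact h'.trans (mul_nonneg (by positivity) (Finset.sum_nonneg fun m _ => hp m))
  · refine le_of_mul_le_mul_left ?_ (mul_pos hC (pow_pos h0 (N - k)))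
    rw [scenarioPoly, sub_nonpos] at hpoly
    calc (N.choose k : ℝ) * t ^ (N - k) * compressionProb q c N K
        ≤ (β / N * ∑ i ∈ Finset.Ico k N, (i.choose k : ℝ) * t ^ (i - k))
          * compressionProb q c N K := mul_le_mul_of_nonneg_right hpoly (hp N)
      _ = β / N * ∑ i ∈ Finset.Ico k N,
          t ^ (i - k) * (i.choose k * compressionProb q c N K) := by
        rw [mul_assoc, Finset.sum_mul]
        congr 1
        exact Finset.sum_congr rfl fun i _ => by ring
      _ ≤ β / N * ∑ i ∈ Finset.Ico k N,
          N.choose k * t ^ (N - k) * compressionProb q c i K := by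
        refine mul_le_mul_of_nonneg_left (Finset.sum_le_sum fun i hi => ?_) (by positivity)
        rw [Finset.mem_Ico] at hi
        calc t ^ (i - k) * (i.choose k * compressionProb q c N K)
            ≤ t ^ (i - k) * (N.choose k * t ^ (N - i) * compressionProb q c i K) :=
              mul_le_mul_of_nonneg_left (hle hi.1 hi.2.le) (by positivity)
          _ = N.choose k * (t ^ (N - i) * t ^ (i - k)) * compressionProb q c i K := by ring
          _ = _ := by rw [← pow_add, show N - i + (i - k) = N - k by omega]
      _ = _ := by
        rw [← Finset.mul_sum]
        ring

/-- The scenario bound for compression maps on a finite sample space: with probability at most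
`β`, the violation probability of the compressed sample exceeds `ε(#(compressed sample), β, N)`. -/
theorem sum_prod_violation_le (hq : ∀ z, 0 ≤ q z) (hq1 : ∑ z, q z = 1)
    (hsub : ∀ D, c D ⊆ D) (hpref : ∀ D D', c D ⊆ D' → D' ⊆ D → c D' = c D)
    (A : Finset Z → Finset Z) (hA : ∀ D, D ⊆ A (c D)) (N : ℕ) {β : ℝ}
    (hβ : 0 < β) (hβ1 : β < 1) (B : Finset (Fin N → Z))
    (hB : ∀ ω ∈ B, scenarioEps (c (Finset.univ.image ω)).card β N
      < 1 - ∑ z ∈ A (c (Finset.univ.image ω)), q z) :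
    ∑ ω ∈ B, ∏ i, q (ω i) ≤ β := by
  classical
  have hp : ∀ m K, 0 ≤ compressionProb q c m K := fun m K => compressionProb_nonneg hq m K
  have h1 : ∑ ω ∈ B, ∏ i, q (ω i)
      = ∑ K, ∑ ω ∈ B, if c (Finset.univ.image ω) = K then ∏ i, q (ω i) else 0 := by
    rw [Finset.sum_comm]
    simp
  -- Badness in `hB` depends on `ω` only through its compression, so one bad sample compressed to
  -- `K` provides the hypothesis for `K`.
  have h2 : ∀ K, (∑ ω ∈ B, if c (Finset.univ.image ω) = K then ∏ i, q (ω i) else 0)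
      ≤ β / N * ∑ m ∈ Finset.range N, compressionProb q c m K := by
    intro K
    by_cases hK : ∃ ω ∈ B, c (Finset.univ.image ω) = K
    · obtain ⟨ω, hω, rfl⟩ := hK
      refine le_trans ?_ (compressionProb_le_of_lt hq hsub hpref A hA _ hβ hβ1 (hB ω hω))
      refine Finset.sum_le_sum_of_subset_of_nonneg (Finset.subset_univ _) fun ω' _ _ => ?_
      split_ifs
      · exact Finset.prod_nonneg fun i _ => hq _
      · exact le_rfl
    · rw [Finset.sum_eq_zero]
      · exact mul_nonneg (by positivity) (Finset.sum_nonneg fun m _ => hp m K)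
      · intro ω hω
        rw [if_neg fun h => hK ⟨ω, hω, h⟩]
  rw [h1]
  refine (Finset.sum_le_sum fun K _ => h2 K).trans ?_
  rw [← Finset.mul_sum, Finset.sum_comm]
  simp only [sum_compressionProb hq1, Finset.sum_const, Finset.card_range, nsmul_eq_mul, mul_one]
  -- For `N = 0` the quotient `β / N` is `0` by convention and cannot be cancelled.
  rcases N.eq_zero_or_pos with rfl | hN
  · simpa using hβ.le
  · rw [div_mul_cancel₀]
    positivity

end Compression

theorem AltSeq.finite (M A : Type*) [Finite M] [Finite A] (n : ℕ) : Finite (AltSeq M A n) :=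
  Finite.of_injective (fun s : AltSeq M A n => (s.m, s.a)) fun s t h => by
    rw [Prod.mk.injEq] at h
    exact AltSeq.ext h.1 h.2

theorem lSeqs_mono {Y U : Type*} {H : ℕ} (ℓ : ℕ) :
    Monotone (lSeqs ℓ : Set (AltSeq Y U H) → Set (AltSeq (Option Y) (Option U) ℓ)) := by
  rintro D D' hD _ ⟨γ, hγ, k, rfl⟩
  exact ⟨γ, hD hγ, k, rfl⟩

/-! ### Windows of a sequence and the transitions of the abstraction. -/

section Windows

variable {M A : Type*} {n : ℕ}

theorem AltSeq.window_m_succ (s : AltSeq M A n) (ℓ : ℕ) (k : Fin (n + 1)) (i : Fin (ℓ + 1)) :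
    (s.window (ℓ + 1) k).m i.succ = (s.window ℓ k).m i := by
  simp only [AltSeq.window, Fin.val_succ]
  have h1 : ℓ + 1 ≤ (k : ℕ) + (i + 1) ↔ ℓ ≤ (k : ℕ) + i := by omega
  have h2 : (k : ℕ) + (i + 1) - (ℓ + 1) = (k : ℕ) + i - ℓ := by omega
  simp only [h1, h2]

theorem AltSeq.window_a_succ (s : AltSeq M A n) (ℓ : ℕ) (k : Fin (n + 1)) (i : Fin ℓ) :
    (s.window (ℓ + 1) k).a i.succ = (s.window ℓ k).a i := by
  simp only [AltSeq.window, Fin.val_succ]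
  have h1 : ℓ + 1 ≤ (k : ℕ) + (i + 1) ↔ ℓ ≤ (k : ℕ) + i := by omega
  have h2 : (k : ℕ) + (i + 1) - (ℓ + 1) = (k : ℕ) + i - ℓ := by omega
  simp only [h1, h2]

theorem AltSeq.window_last (s : AltSeq M A n) (ℓ : ℕ) (k : Fin (n + 1)) :
    (s.window ℓ k).m (Fin.last ℓ) = some (s.m k) := by
  simp [AltSeq.window]

theorem AltSeq.window_m_shift (s : AltSeq M A n) (ℓ : ℕ) (k : Fin n) (i : Fin ℓ) :
    (s.window ℓ k.castSucc).m i.succ = (s.window ℓ k.succ).m i.castSucc := by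
  simp only [AltSeq.window, Fin.val_succ, Fin.val_castSucc]
  have h1 : (k : ℕ) + (i + 1) = k + 1 + i := by omega
  simp only [h1]

theorem AltSeq.window_a_shift (s : AltSeq M A n) (ℓ : ℕ) (k : Fin n) {i j : Fin ℓ}
    (hij : (i : ℕ) = j + 1) :
    (s.window ℓ k.castSucc).a i = (s.window ℓ k.succ).a j := by
  simp only [AltSeq.window, Fin.val_succ, Fin.val_castSucc, hij]
  have h1 : (k : ℕ) + (j + 1) = k + 1 + j := by omega
  simp only [h1]

theorem AltSeq.window_succ_a_last (s : AltSeq M A n) (ℓ : ℕ) (k : Fin n) {i : Fin ℓ}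
    (hi : (i : ℕ) + 1 = ℓ) : (s.window ℓ k.succ).a i = some (s.a k) := by
  simp only [AltSeq.window, Fin.val_succ]
  rw [dif_pos (by omega)]
  congr 2
  ext
  simp only
  omega

theorem AltSeq.window_append (s : AltSeq M A n) (ℓ : ℕ) (k : Fin n) :
    (s.window ℓ k.castSucc).append (some (s.a k)) (some (s.m k.succ))
      = s.window (ℓ + 1) k.succ := by
  ext1
  · funext i
    refine Fin.lastCases ?_ (fun i => ?_) i
    · rw [AltSeq.window_last]
      simp [AltSeq.append]
    · simp only [AltSeq.append, Fin.snoc_castSucc, AltSeq.window, Fin.val_castSucc, Fin.val_succ]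
      have h1 : ℓ + 1 ≤ (k : ℕ) + 1 + i ↔ ℓ ≤ (k : ℕ) + i := by omega
      have h2 : (k : ℕ) + 1 + i - (ℓ + 1) = (k : ℕ) + i - ℓ := by omega
      simp only [h1, h2]
  · funext i
    refine Fin.lastCases ?_ (fun i => ?_) i
    · rw [AltSeq.window_succ_a_last s (ℓ + 1) k (by simp)]
      simp [AltSeq.append]
    · simp only [AltSeq.append, Fin.snoc_castSucc, AltSeq.window, Fin.val_castSucc, Fin.val_succ]
      have h1 : ℓ + 1 ≤ (k : ℕ) + 1 + i ↔ ℓ ≤ (k : ℕ) + i := by omega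
      have h2 : (k : ℕ) + 1 + i - (ℓ + 1) = (k : ℕ) + i - ℓ := by omega
      simp only [h1, h2]

/-- Dropping the first output and input of an `(ℓ+1)`-window leaves the `ℓ`-window at the same time.
This makes the `ℓ`-windows states of the abstraction. -/
theorem window_mem_lSeqs_of_succ {ℓ : ℕ} {γ : AltSeq M A n} {D : Set (AltSeq M A n)}
    {k : Fin (n + 1)} (h : γ.window (ℓ + 1) k ∈ lSeqs (ℓ + 1) D) : γ.window ℓ k ∈ lSeqs ℓ D := by
  obtain ⟨γ', hγ', k', he⟩ := h
  refine ⟨γ', hγ', k', ?_⟩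
  ext1
  · funext i
    rw [← γ.window_m_succ, he, AltSeq.window_m_succ]
  · funext i
    rw [← γ.window_a_succ, he, AltSeq.window_a_succ]

end Windows

/-- A behavior of `S` all of whose `(ℓ+1)`-sequences occur in the data is a behavior of the
data-driven abstraction. -/
theorem mem_extBeh_dataDrivenSALCA {X U Y : Type*} {S : TransitionSystem X U Y} {H ℓ : ℕ}
    {D : Set (AltSeq Y U H)} {γ : AltSeq Y U H} (hγ : γ ∈ S.extBeh H)
    (hw : lSeqs (ℓ + 1) {γ} ⊆ lSeqs (ℓ + 1) D) : γ ∈ (dataDrivenSALCA S ℓ D).extBeh H := by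
  have hmem : ∀ k, γ.window (ℓ + 1) k ∈ lSeqs (ℓ + 1) D := fun k => hw ⟨γ, rfl, k, rfl⟩
  obtain ⟨ξ, hξ, hγξ⟩ := hγ
  -- The run of the abstraction visits the successive `ℓ`-windows of `γ`; its first state is initial
  -- because `γ` itself is a behavior of `S`.
  refine ⟨⟨fun k => ⟨γ.window ℓ k, window_mem_lSeqs_of_succ (hmem k)⟩, γ.a⟩,
    ⟨⟨ξ, hξ, by rw [← hγξ]⟩, fun k => ⟨?_, ?_, ?_, ?_⟩⟩, ?_⟩
  · exact fun i => γ.window_m_shift ℓ k i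
  · exact fun i j hij => γ.window_a_shift ℓ k hij
  · exact fun i hi => γ.window_succ_a_last ℓ k hi
  · simp only [AltSeq.window_last, AltSeq.window_append]
    exact hmem k.succ
  · ext1
    · funext k
      simp [TransitionSystem.outSeq, dataDrivenSALCA, AltSeq.window_last]
    · rfl

/-! ### The concrete system: determinism and measurability. -/

section Trajectory

/-- The state sequence of the map `g` from `x` under the inputs `u`. -/
def trajectory {X U : Type*} (g : X → U → X) {H : ℕ} (x : X) (u : Fin H → U) : Fin (H + 1) → X :=
  Fin.induction x fun i s => g s (u i)

variable {n m : ℕ} {X : Set (EuclideanSpace ℝ (Fin n))} {U : Set (EuclideanSpace ℝ (Fin m))}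
  {Y : Type*} (f : X → U → EuclideanSpace ℝ (Fin n)) (h : X → Y) {H : ℕ}

/-- The external behavior of the concrete system from a given state under given inputs. -/
noncomputable def behavior (p : (X ⊕ Unit) × (Fin H → U)) : AltSeq (Y ⊕ Unit) U H :=
  (concreteTS f h).outSeq ⟨trajectory (step f) p.1 p.2, p.2⟩

theorem extBehFrom_concreteTS (x : X ⊕ Unit) (u : Fin H → U) :
    (concreteTS f h).extBehFrom H x u = {behavior f h (x, u)} := by
  have hint : (⟨trajectory (step f) x u, u⟩ : AltSeq (X ⊕ Unit) U H)
      ∈ (concreteTS f h).intBeh H := by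
    refine ⟨Set.mem_univ _, fun i => ?_⟩
    simp [concreteTS, trajectory]
  ext γ
  constructor
  · rintro ⟨-, ξ, ⟨⟨-, hδ⟩, hx, hu⟩, rfl⟩
    have hm : ∀ k, ξ.m k = trajectory (step f) x u k := by
      intro k
      induction k using Fin.induction with
      | zero => simpa [trajectory] using hx
      | succ i ih =>
        have := hδ i
        simp only [concreteTS] at this
        rw [this, ih, hu]
        simp [trajectory]
    rw [Set.mem_singleton_iff, behavior]
    congr 1
    exact AltSeq.ext (funext hm) hu
  · rintro rfl
    exact ⟨⟨_, hint, rfl⟩, _, ⟨hint, by simp [trajectory], rfl⟩, rfl⟩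

theorem behavior_mem_extBeh (p : (X ⊕ Unit) × (Fin H → U)) :
    behavior f h p ∈ (concreteTS f h).extBeh H := by
  have : behavior f h p ∈ (concreteTS f h).extBehFrom H p.1 p.2 := by
    rw [extBehFrom_concreteTS]
    rfl
  exact this.1

theorem sampledBeh_concreteTS {N : ℕ} (ω : Fin N → (X ⊕ Unit) × (Fin H → U)) :
    (concreteTS f h).sampledBeh H ω = Set.range fun i => behavior f h (ω i) := by
  ext γ
  simp [TransitionSystem.sampledBeh, extBehFrom_concreteTS, eq_comm]

theorem violationSet_concreteTS {X' : Type*} (S' : TransitionSystem X' U (Y ⊕ Unit)) :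
    violationSet (concreteTS f h) S' H = behavior f h ⁻¹' {γ | γ ∉ S'.extBeh H} := by
  ext p
  simp [violationSet, extBehFrom_concreteTS]

variable {f h}

theorem measurable_step (hX : MeasurableSet X) (hf : ∀ u, Measurable fun x => f x u) (u : U) :
    Measurable fun s => step f s u := by
  classical
  refine measurable_fun_sum ?_ measurable_const
  have hpre : MeasurableSet {x : X | f x u ∈ X} := hf u hX
  have h1 : Measurable fun x : {x : X | f x u ∈ X} =>
      (Sum.inl ⟨f x.1 u, x.2⟩ : X ⊕ Unit) :=
    measurable_inl.comp (((hf u).comp measurable_subtype_coe).subtype_mk)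
  have h2 : Measurable fun _ : ({x : X | f x u ∈ X}ᶜ : Set X) => (Sum.inr () : X ⊕ Unit) :=
    measurable_const
  convert Measurable.dite h1 h2 hpre using 1
  funext x
  simp only [Function.comp_apply, step, Set.mem_ofPred_eq]

theorem measurable_trajectory (hX : MeasurableSet X) (hf : ∀ u, Measurable fun x => f x u)
    (u : Fin H → U) (k : Fin (H + 1)) : Measurable fun x => trajectory (step f) x u k := by
  induction k using Fin.induction with
  | zero => exact measurable_id
  | succ i ih => exact (measurable_step hX hf (u i)).comp ih

theorem measurableSet_behavior_fiber (hX : MeasurableSet X)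
    (hf : ∀ u, Measurable fun x => f x u) (hh : ∀ y, MeasurableSet (h ⁻¹' {y}))
    (γ : AltSeq (Y ⊕ Unit) U H) : MeasurableSet (behavior f h ⁻¹' {γ}) := by
  have hout : ∀ y, MeasurableSet ((Sum.map h id : X ⊕ Unit → Y ⊕ Unit) ⁻¹' {y}) := by
    intro y
    rw [measurableSet_sum_iff]
    refine ⟨?_, MeasurableSet.of_discrete⟩
    cases y with
    | inl y =>
      convert hh y using 1
      ext x
      simp
    | inr y =>
      convert MeasurableSet.empty using 1
      ext x
      simp
  -- A behavior records its input word, so the fiber is a rectangle and only trajectories under the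
  -- fixed word `γ.a` need to be measurable.
  have heq : behavior f h ⁻¹' {γ} = {x | ∀ k, trajectory (step f) x γ.a k
      ∈ (Sum.map h id : X ⊕ Unit → Y ⊕ Unit) ⁻¹' {γ.m k}} ×ˢ {γ.a} := by
    ext ⟨x, u⟩
    simp only [Set.mem_preimage, Set.mem_singleton_iff, Set.mem_prod, Set.mem_ofPred_eq]
    constructor
    · rintro rfl
      exact ⟨fun k => rfl, rfl⟩
    · rintro ⟨hm, rfl⟩
      exact AltSeq.ext (funext hm) rfl
  rw [heq]
  refine MeasurableSet.prod ?_ (measurableSet_singleton _)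
  rw [Set.ofPred_forall]
  exact MeasurableSet.iInter fun k => measurable_trajectory hX hf γ.a k (hout _)

end Trajectory

/-! ### Reduction of the probabilistic guarantee to finite sums. -/

theorem complexity_eq_card {Y U : Type*} {H ℓ : ℕ} {D C : Finset (AltSeq Y U H)} (hC : C ⊆ D)
    (hCD : lSeqs (ℓ + 1) (C : Set (AltSeq Y U H)) = lSeqs (ℓ + 1) (D : Set (AltSeq Y U H)))
    (hmin : ∀ B ⊆ D, lSeqs (ℓ + 1) (B : Set (AltSeq Y U H))
      = lSeqs (ℓ + 1) (D : Set (AltSeq Y U H)) → C.card ≤ B.card) :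
    complexity ℓ (D : Set (AltSeq Y U H)) = C.card := by
  refine le_antisymm (Nat.sInf_le ⟨C, by exact_mod_cast hC, hCD, by simp⟩) ?_
  refine le_csInf ⟨C.card, C, by exact_mod_cast hC, hCD, by simp⟩ ?_
  rintro k ⟨B, hB, hBD, hk⟩
  lift B to Finset (AltSeq Y U H) using D.finite_toSet.subset hB
  rw [Set.encard_coe_eq_coe_finsetCard] at hk
  have hk' : B.card = k := by exact_mod_cast hk
  exact hk' ▸ hmin B (by exact_mod_cast hB) hBD

/-- The probability of a set of samples that is determined by a finite-valued observable. -/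
theorem pi_preimage_eq_sum {Ω Z : Type*} [MeasurableSpace Ω] [Fintype Z] (μ : Measure Ω)
    [IsProbabilityMeasure μ] {b : Ω → Z} (hb : ∀ z, MeasurableSet (b ⁻¹' {z})) {N : ℕ}
    (B : Finset (Fin N → Z)) :
    MeasurableSet {ω : Fin N → Ω | (fun i => b (ω i)) ∈ B} ∧
    Measure.pi (fun _ : Fin N => μ) {ω | (fun i => b (ω i)) ∈ B}
      = ENNReal.ofReal (∑ z ∈ B, ∏ i, μ.real (b ⁻¹' {z i})) := by
  have heq : {ω : Fin N → Ω | (fun i => b (ω i)) ∈ B}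
      = ⋃ z ∈ B, Set.univ.pi fun i => b ⁻¹' {z i} := by
    ext ω
    simp only [Set.mem_ofPred_eq, Set.mem_iUnion, Set.mem_pi, Set.mem_univ, true_imp_iff,
      Set.mem_preimage, Set.mem_singleton_iff, exists_prop]
    constructor
    · exact fun hω => ⟨_, hω, fun i => rfl⟩
    · rintro ⟨z, hz, hω⟩
      rwa [funext hω]
  have hmeas : ∀ z : Fin N → Z, MeasurableSet (Set.univ.pi fun i => b ⁻¹' {z i}) := fun z =>
    MeasurableSet.univ_pi fun i => hb _
  rw [heq]
  refine ⟨Finset.measurableSet_biUnion _ fun z _ => hmeas z, ?_⟩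
  rw [measure_biUnion_finset ?_ fun z _ => hmeas z, ENNReal.ofReal_sum_of_nonneg]
  · refine Finset.sum_congr rfl fun z _ => ?_
    rw [Measure.pi_pi, ENNReal.ofReal_prod_of_nonneg fun i _ => measureReal_nonneg]
    simp
  · exact fun z _ => Finset.prod_nonneg fun i _ => measureReal_nonneg
  · intro z _ z' _ hne
    refine Set.disjoint_left.2 fun ω h1 h2 => hne (funext fun i => ?_)
    simp only [Set.mem_pi, Set.mem_univ, true_imp_iff, Set.mem_preimage,
      Set.mem_singleton_iff] at h1 h2
    rw [← h1 i, ← h2 i]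

theorem measure_preimage_eq_sum {Ω Z : Type*} [MeasurableSpace Ω] [Fintype Z] (μ : Measure Ω)
    [IsProbabilityMeasure μ] {b : Ω → Z} (hb : ∀ z, MeasurableSet (b ⁻¹' {z}))
    (B : Finset Z) :
    MeasurableSet (b ⁻¹' B) ∧
    μ (b ⁻¹' B) = ENNReal.ofReal (∑ z ∈ B, μ.real (b ⁻¹' {z})) := by
  have heq : b ⁻¹' (B : Set Z) = ⋃ z ∈ B, b ⁻¹' {z} := by
    ext ω
    simp
  rw [heq]
  refine ⟨Finset.measurableSet_biUnion _ fun z _ => hb z, ?_⟩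
  rw [measure_biUnion_finset ?_ fun z _ => hb z, ENNReal.ofReal_sum_of_nonneg]
  · simp
  · exact fun z _ => measureReal_nonneg
  · intro z _ z' _ hne
    exact Set.disjoint_left.2 fun ω h1 h2 => hne (h1.symm.trans h2)

/-- The guarantee for the data-driven abstraction, for an arbitrary observation map `b` into a
finite set of external behaviors of `S`. -/
theorem dataDrivenSALCA_guarantee {X U Y Ω : Type*} [MeasurableSpace Ω]
    (S : TransitionSystem X U Y) {H : ℕ} (ℓ N : ℕ) [Finite (AltSeq Y U H)]
    {b : Ω → AltSeq Y U H} (hb : ∀ γ, MeasurableSet (b ⁻¹' {γ})) (hbS : ∀ p, b p ∈ S.extBeh H)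
    (μ : Measure Ω) [IsProbabilityMeasure μ]
    {D : (Fin N → Ω) → Set (AltSeq Y U H)} (hD : ∀ ω, D ω = Set.range fun i => b (ω i))
    {β : ℝ} (hβ : 0 < β) (hβ1 : β < 1) :
    let T : (Fin N → Ω) → Set Ω := fun ω =>
      b ⁻¹' {γ | γ ∉ (dataDrivenSALCA S ℓ (D ω)).extBeh H}
    let good : Set (Fin N → Ω) :=
      {ω | μ (T ω) ≤ ENNReal.ofReal (scenarioEps (complexity ℓ (D ω)) β N)}
    (∀ ω, MeasurableSet (T ω)) ∧ MeasurableSet good ∧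
      ENNReal.ofReal (1 - β) ≤ Measure.pi (fun _ : Fin N => μ) good := by
  classical
  obtain rfl : D = fun ω => Set.range fun i => b (ω i) := funext hD
  intro T good
  have : Fintype (AltSeq Y U H) := Fintype.ofFinite _
  have hpre : ∀ B : Set (AltSeq Y U H), MeasurableSet (b ⁻¹' B) ∧
      μ (b ⁻¹' B) = ENNReal.ofReal (∑ z ∈ B.toFinset, μ.real (b ⁻¹' {z})) := fun B => by
    simpa using measure_preimage_eq_sum μ hb B.toFinset
  let q : AltSeq Y U H → ℝ := fun γ => μ.real (b ⁻¹' {γ})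
  have hq : ∀ γ, 0 ≤ q γ := fun γ => measureReal_nonneg
  have hq1 : ∑ γ, q γ = 1 := by
    have h1 := (hpre Set.univ).2
    simp only [Set.preimage_univ, measure_univ, Set.toFinset_univ] at h1
    exact (ENNReal.ofReal_eq_one.1 h1.symm)
  let F : Finset (AltSeq Y U H) → Set (AltSeq (Option Y) (Option U) (ℓ + 1)) :=
    fun B => lSeqs (ℓ + 1) (B : Set (AltSeq Y U H))
  obtain ⟨c, hsub, hF, hmin, hpref⟩ := exists_minimal_compression F
    fun B B' hB => lSeqs_mono (ℓ + 1) (Finset.coe_subset.2 hB)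
  -- The behaviors without new windows. Only their being reproduced is needed, so the complement may
  -- overestimate the violation set.
  let A : Finset (AltSeq Y U H) → Finset (AltSeq Y U H) :=
    fun B => Finset.univ.filter fun γ => lSeqs (ℓ + 1) {γ} ⊆ F B
  have hA : ∀ B, B ⊆ A (c B) := fun B γ hγ => by
    simp only [A, Finset.mem_filter, Finset.mem_univ, true_and, hF]
    exact lSeqs_mono (ℓ + 1) (Set.singleton_subset_iff.2 hγ)
  let bad : Finset (Fin N → AltSeq Y U H) := Finset.univ.filter fun z =>
    ¬ μ (b ⁻¹' {γ | γ ∉ (dataDrivenSALCA S ℓ (Set.range z)).extBeh H})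
      ≤ ENNReal.ofReal (scenarioEps (complexity ℓ (Set.range z)) β N)
  have hbad : ∀ z ∈ bad, scenarioEps (c (Finset.univ.image z)).card β N
      < 1 - ∑ γ ∈ A (c (Finset.univ.image z)), q γ := by
    intro z hz
    have hz := (Finset.mem_filter.1 hz).2
    have hrange : Set.range z = ((Finset.univ.image z : Finset _) : Set (AltSeq Y U H)) := by simp
    rw [hrange, complexity_eq_card (hsub _) (hF _) (hmin _)] at hz
    set E := Finset.univ.image z
    by_contra! hle
    refine hz ?_
    have hcompl : ∑ γ ∈ (A (c E))ᶜ, q γ = 1 - ∑ γ ∈ A (c E), q γ := by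
      rw [← hq1, ← Finset.sum_add_sum_compl (A (c E)) q]
      ring
    have hm := (measure_preimage_eq_sum μ hb (A (c E))ᶜ).2
    refine (measure_mono (t := b ⁻¹' ((A (c E))ᶜ : Finset _)) ?_).trans
      (hm.trans_le (ENNReal.ofReal_le_ofReal (hcompl.trans_le hle)))
    intro p hp
    simp only [Set.mem_preimage, Finset.coe_compl, Set.mem_compl_iff, Finset.mem_coe, A,
      Finset.mem_filter, Finset.mem_univ, true_and, hF]
    exact fun hpw => hp (mem_extBeh_dataDrivenSALCA (hbS p) hpw)
  have hsum := sum_prod_violation_le hq hq1 hsub hpref A hA N hβ hβ1 bad hbad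
  -- The event depends only on the observed behaviors, so it is measurable and its probability is a
  -- finite sum.
  have hgood : good = {ω | (fun i => b (ω i)) ∈ bad}ᶜ := by
    ext ω
    simp [good, bad, T]
  obtain ⟨hmeas, hprob⟩ := pi_preimage_eq_sum μ hb bad
  refine ⟨fun ω => (hpre _).1, hgood ▸ hmeas.compl, ?_⟩
  rw [hgood, prob_compl_eq_one_sub hmeas, hprob, ENNReal.ofReal_sub _ hβ.le, ENNReal.ofReal_one]
  exact tsub_le_tsub_left (ENNReal.ofReal_le_ofReal hsum) _

end SALCA

theorem mainTheorem4 {n m : ℕ}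
    (X : Set (EuclideanSpace ℝ (Fin n))) (hX : MeasurableSet X)
    (U : Set (EuclideanSpace ℝ (Fin m))) (hU : U.Finite)
    {Y : Type*} [Finite Y]
    (f : X → U → EuclideanSpace ℝ (Fin n)) (hf : ∀ u, Measurable fun x => f x u)
    (h : X → Y) (hh : ∀ y, MeasurableSet (h ⁻¹' {y}))
    (H ℓ N : ℕ) (hℓ : ℓ < H)
    (μx : Measure (X ⊕ Unit)) [IsProbabilityMeasure μx]
    (μu : Measure (Fin H → U)) [IsProbabilityMeasure μu]
    (β : ℝ) (hβ : 0 < β) (hβ1 : β < 1) :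
    let S := SALCA.concreteTS f h
    let μp : Measure ((X ⊕ Unit) × (Fin H → U)) := μx.prod μu
    let D : (Fin N → (X ⊕ Unit) × (Fin H → U)) → Set (SALCA.AltSeq (Y ⊕ Unit) U H) :=
      fun ω => S.sampledBeh H ω
    let T : (Fin N → (X ⊕ Unit) × (Fin H → U)) → Set ((X ⊕ Unit) × (Fin H → U)) :=
      fun ω => SALCA.violationSet S (SALCA.dataDrivenSALCA S ℓ (D ω)) H
    let good : Set (Fin N → (X ⊕ Unit) × (Fin H → U)) :=
      {ω | μp (T ω) ≤ ENNReal.ofReal (SALCA.scenarioEps (SALCA.complexity ℓ (D ω)) β N)}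
    (∀ ω, MeasurableSet (T ω)) ∧ MeasurableSet good ∧
      ENNReal.ofReal (1 - β) ≤ Measure.pi (fun _ : Fin N => μp) good := by
  intro S μp D T good
  have : Finite U := hU
  have : Finite (SALCA.AltSeq (Y ⊕ Unit) U H) := SALCA.AltSeq.finite _ _ _
  have key := SALCA.dataDrivenSALCA_guarantee S ℓ N (b := SALCA.behavior f h)
    (SALCA.measurableSet_behavior_fiber hX hf hh) (SALCA.behavior_mem_extBeh f h) μp
    (SALCA.sampledBeh_concreteTS f h) hβ hβ1
  simpa only [T, good, D, S, SALCA.violationSet_concreteTS] using key
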